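/- Let $d$ be a dimension and let $K:\mathbb R^d\to\mathbb R$ be a function which is either radial, $K(x)=K^{(0)}(|x|)$ for all $x$ (with $|\cdot|$ the Euclidean norm), or of product form, $K(x)=\prod_{k=1}^d K^{(0)}(x_k)$ for all $x$, where $K^{(0)}:\mathbb R\to\mathbb R$ is a bounded function of (finite total) bounded variation on $\mathbb R$. Put $K_\infty=\sup_{x\in\mathbb R^d}|K(x)|$ and $$\mathcal F=\big\{(t,x)\mapsto t\,\mathbb 1_{t\le M}\,K\big(h^{-1}(y-x)\big)\;:\;y\in\mathbb R^d,\ h>0,\ M\in\mathbb R\big\},$$ a class of functions on $\mathbb R\times\mathbb R^d$. Then $\mathcal F$ is a VC class of (measurable) functions with envelope $$F(t,x)=2\big((1\vee K_\infty)|t|+(1\vee|t|)K_\infty\big),$$ that is, $|f(t,x)|\le F(t,x)$ for all $f\in\mathcal F$ and all $(t,x)\in\mathbb R\times\mathbb R^d$, and there exist $A>0$ and $v>0$ such that, for every Borel probability measure $Q$ on $\mathbb R\times\mathbb R^d$ with $\|F\|_{L_2(Q)}<\infty$ and every $0<\epsilon<1$, $$\mathcal N\big(\mathcal F,L_2(Q),\epsilon\|F\|_{L_2(Q)}\big)\le\Big(\frac{A}{\epsilon}\Big)^{v}.$$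 Here $\mathcal N(T,\rho,\delta)$ is the $\delta$-covering number of $(T,\rho)$: the smallest number of closed $\rho$-balls of radius $\delta$ with centres in $T$ that cover $T$. -/

import Mathlib

open MeasureTheory Metric
open scoped NNReal ENNReal

/-- `F` is an envelope of the class `𝓕` of real functions on `X`: `|f x| ≤ F x` for all
`f ∈ 𝓕` and all `x`. -/
def IsEnvelope {X : Type*} (𝓕 : Set (X → ℝ)) (F : X → ℝ) : Prop :=
  ∀ f ∈ 𝓕, ∀ x, |f x| ≤ F x

/-- The class `𝓕` seen as a subset of the metric space `L²(Q)`. -/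
def l2Class {X : Type*} [MeasurableSpace X] (𝓕 : Set (X → ℝ)) (Q : Measure X) :
    Set (Lp ℝ 2 Q) :=
  {g | ∃ f ∈ 𝓕, g =ᵐ[Q] f}

/-- `𝓕` is a VC class of functions with envelope `F`: all functions are measurable, `F` is an
envelope of `𝓕`, and there are `A, v > 0` such that
`N(𝓕, L²(Q), ε ‖F‖_{L²(Q)}) ≤ (A / ε) ^ v` for every probability measure `Q` with
`‖F‖_{L²(Q)} < ∞` and every `0 < ε < 1`. (By measurability and the envelope condition, every
`f ∈ 𝓕` is then in `L²(Q)`, so that no member of `𝓕` is lost in `l2Class 𝓕 Q`.) -/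
def IsVCClassWithEnvelope {X : Type*} [MeasurableSpace X] (𝓕 : Set (X → ℝ)) (F : X → ℝ) :
    Prop :=
  (∀ f ∈ 𝓕, Measurable f) ∧ Measurable F ∧ IsEnvelope 𝓕 F ∧
    ∃ A v : ℝ, 0 < A ∧ 0 < v ∧
      ∀ Q : Measure X, IsProbabilityMeasure Q → MemLp F 2 Q →
        ∀ ε : ℝ≥0, 0 < ε → ε < 1 →
          (coveringNumber (ε * (eLpNorm F 2 Q).toNNReal) (l2Class 𝓕 Q) : ℝ≥0∞) ≤
            ENNReal.ofReal ((A / (ε : ℝ)) ^ v)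

/-- `K` is a radial kernel with profile `K₀`, for the Euclidean norm. -/
def IsRadialKernel {d : ℕ} (K₀ : ℝ → ℝ) (K : EuclideanSpace ℝ (Fin d) → ℝ) : Prop :=
  ∀ x, K x = K₀ ‖x‖

/-- `K` is a product kernel with profile `K₀`. -/
def IsProductKernel {d : ℕ} (K₀ : ℝ → ℝ) (K : EuclideanSpace ℝ (Fin d) → ℝ) : Prop :=
  ∀ x, K x = ∏ k, K₀ (x k)

/-- The supremum norm `K_∞ = sup_x |K x|`. -/
noncomputable def kernelSup {d : ℕ} (K : EuclideanSpace ℝ (Fin d) → ℝ) : ℝ :=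
  ⨆ x, |K x|

/-- The class of functions `(t, x) ↦ t 1_{t ≤ M} K (h⁻¹ (y - x))` on `ℝ × ℝᵈ`, for `y ∈ ℝᵈ`,
`h > 0` and `M ∈ ℝ`. -/
noncomputable def truncatedKernelClass {d : ℕ} (K : EuclideanSpace ℝ (Fin d) → ℝ) :
    Set (ℝ × EuclideanSpace ℝ (Fin d) → ℝ) :=
  {f | ∃ (y : EuclideanSpace ℝ (Fin d)) (h M : ℝ), 0 < h ∧
    f = fun p => p.1 * (Set.Iic M).indicator (fun _ => (1 : ℝ)) p.1 * K (h⁻¹ • (y - p.2))}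

/-! Parametrise the class by θ = (y, h, M). The variation function of K⁽⁰⁾ gives a monotone φ with
values in [0, 1] whose increments dominate those of K⁽⁰⁾ up to a constant. The increments of a
member in θ are thus controlled by finitely many functions ψ(a/b), with ψ monotone and a, b linear
in a fixed finite list of monomials of θ. The ratios are (y_k - x_k)/h for a product kernel, |y -
x|²/h² for a radial one (ψ absorbs the square root), and (M - t)/1 for the truncation. For a fixed
point and height s, the event s < ψ(a/b) is then an open or closed half-space condition on the
features.

In dimension D, N such conditions realise at most (N + 1)^D patterns, by Sauer–Shelah
(`card_le_of_isLinearThreshold`). If m parameters are p-separated in L¹, each pair in at least one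
of q families, a random point with a uniform height distinguishes any given pair with probability at
least p. Hence about 2 log m / p points distinguish all pairs, and m ≤ (nq + 1)^D bounds m
polynomially in 1/p (`card_le_of_lintegral_separated`).

Squared differences of members are at most t² times a sum of L¹ increments. Normalising t² dQ to a
probability measure and using |t| ≤ F turns ε‖F‖-separation in L²(Q) into L¹ separation of order ε²
(`exists_coveringNumber_le`). -/

/-! ### Counting patterns of linear thresholds -/

/-- `P` is a linear threshold event in the parameter `w θ`: it is of the form `0 < ℓ (w θ)` or
`0 ≤ ℓ (w θ)` for a linear functional `ℓ`. -/
def IsLinearThreshold {Θ W : Type*} [AddCommGroup W] [Module ℝ W] (w : Θ → W)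
    (P : Θ → Prop) : Prop :=
  ∃ ℓ : Module.Dual ℝ W, (∀ θ, P θ ↔ 0 < ℓ (w θ)) ∨ (∀ θ, P θ ↔ 0 ≤ ℓ (w θ))

theorem sum_Iic_choose_le_pow (N D : ℕ) :
    ∑ k ∈ Finset.Iic D, N.choose k ≤ (N + 1) ^ D := by
  have h : ∀ D, ∑ k ∈ Finset.range (D + 1), N.choose k ≤ (N + 1) ^ D := by
    intro D
    induction D with
    | zero => simp
    | succ D ih =>
      rw [Finset.sum_range_succ]
      have h1 : N.choose (D + 1) ≤ N ^ (D + 1) := Nat.choose_le_pow _ _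
      have h2 : N ^ D ≤ (N + 1) ^ D := Nat.pow_le_pow_left (Nat.le_succ N) D
      calc _ ≤ (N + 1) ^ D + N ^ D * N := by rw [← pow_succ]; exact add_le_add ih h1
        _ ≤ (N + 1) ^ D + (N + 1) ^ D * N := by gcongr
        _ = _ := by ring
  have h3 : Finset.Iic D = Finset.range (D + 1) := by ext; simp
  rw [h3]
  exact h D

/-- The thresholds indexed by a linearly dependent family cannot realise all patterns. -/
theorem exists_pattern_not_realised {Θ W J : Type*} [AddCommGroup W] [Module ℝ W] {w : Θ → W}
    {P : J → Θ → Prop} {ℓ : J → Module.Dual ℝ W}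
    (hP : ∀ j, (∀ θ, P j θ ↔ 0 < ℓ j (w θ)) ∨ (∀ θ, P j θ ↔ 0 ≤ ℓ j (w θ)))
    (T : Finset J) (c : J → ℝ) (hc : ∑ j ∈ T, c j • ℓ j = 0) (i : J) (hi : i ∈ T)
    (hci : c i ≠ 0) :
    ∃ U ⊆ T, ∀ θ, ¬ ∀ j ∈ T, (P j θ ↔ j ∈ U) := by
  classical
  -- On the pattern {c j > 0} every term of the vanishing sum is nonnegative, so each term is zero.
  have key : ∀ c : J → ℝ, ∑ j ∈ T, c j • ℓ j = 0 → ∀ θ,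
      (∀ j ∈ T, (P j θ ↔ 0 < c j)) → ∀ j ∈ T, c j * ℓ j (w θ) = 0 := by
    intro c hc θ hθ
    have hsum : ∑ j ∈ T, c j * ℓ j (w θ) = 0 := by
      have := congrArg (fun L : Module.Dual ℝ W => L (w θ)) hc
      simpa [LinearMap.sum_apply] using this
    refine (Finset.sum_eq_zero_iff_of_nonneg fun j hj => ?_).1 hsum
    rcases lt_or_ge 0 (c j) with h | h
    · have := (hθ j hj).2 h
      rcases hP j with hp | hp
      · exact mul_nonneg h.le ((hp θ).1 this).le
      · exact mul_nonneg h.le ((hp θ).1 this)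
    · have := mt (hθ j hj).1 (not_lt.2 h)
      rcases hP j with hp | hp
      · exact mul_nonneg_of_nonpos_of_nonpos h (not_lt.1 (mt (hp θ).2 this))
      · exact mul_nonneg_of_nonpos_of_nonpos h (not_le.1 (mt (hp θ).2 this)).le
  have hc' : ∑ j ∈ T, (-c j) • ℓ j = 0 := by
    refine LinearMap.ext fun v => ?_
    have := congrArg (fun L : Module.Dual ℝ W => L v) hc
    simpa [LinearMap.sum_apply] using this
  by_contra! hcon
  obtain ⟨θ₁, h₁⟩ := hcon (T.filter fun j => 0 < c j) (Finset.filter_subset _ _)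
  obtain ⟨θ₂, h₂⟩ := hcon (T.filter fun j => 0 < -c j) (Finset.filter_subset _ _)
  have h₁' : ∀ j ∈ T, (P j θ₁ ↔ 0 < c j) := fun j hj => by rw [h₁ j hj]; simp [hj]
  have h₂' : ∀ j ∈ T, (P j θ₂ ↔ 0 < -c j) := fun j hj => by rw [h₂ j hj]; simp [hj]
  have e₁ : ℓ i (w θ₁) = 0 := (mul_eq_zero.1 (key c hc θ₁ h₁' i hi)).resolve_left hci
  have e₂ : ℓ i (w θ₂) = 0 :=
    (mul_eq_zero.1 (key (fun j => -c j) hc' θ₂ h₂' i hi)).resolve_left (neg_ne_zero.2 hci)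
  have a₁ := h₁' i hi
  have a₂ := h₂' i hi
  -- At both parameters `ℓ i` vanishes, so `P i` has the same truth value, yet the patterns of `c`
  -- and `-c` disagree at `i`. One pattern alone would not do, since weak inequalities hold at 0.
  rcases hP i with hp | hp <;> rw [hp, e₁] at a₁ <;> rw [hp, e₂] at a₂
  · rcases lt_or_gt_of_ne hci with h | h
    · exact lt_irrefl _ (a₂.2 (by linarith))
    · exact lt_irrefl _ (a₁.2 h)
  · linarith [a₁.1 le_rfl, a₂.1 le_rfl]

/-- Finitely many linear thresholds in dimension `D` realise at most polynomially many patterns. -/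
theorem card_le_of_isLinearThreshold {Θ W J : Type*} [AddCommGroup W] [Module ℝ W]
    [FiniteDimensional ℝ W] [Fintype J] {w : Θ → W} {P : J → Θ → Prop}
    (hP : ∀ j, IsLinearThreshold w (P j)) (S : Finset Θ)
    (hS : ∀ θ ∈ S, ∀ θ' ∈ S, (∀ j, P j θ ↔ P j θ') → θ = θ') :
    S.card ≤ (Fintype.card J + 1) ^ Module.finrank ℝ W := by
  classical
  choose ℓ hℓ using hP
  let tr : Θ → Finset J := fun θ => Finset.univ.filter fun j => P j θ
  let 𝒜 : Finset (Finset J) := S.image tr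
  have hcard : S.card = 𝒜.card := by
    refine (Finset.card_image_of_injOn ?_).symm
    intro θ hθ θ' hθ' h
    refine hS θ hθ θ' hθ' fun j => ?_
    have := Finset.ext_iff.1 h j
    simpa [tr] using this
  have hvc : 𝒜.vcDim ≤ Module.finrank ℝ W := by
    refine Finset.sup_le fun T hT => ?_
    by_contra! hlt
    have hdep : ¬ LinearIndependent ℝ (fun j : T => ℓ j) := by
      intro hli
      have := hli.fintype_card_le_finrank
      rw [Subspace.dual_finrank_eq, Fintype.card_coe] at this
      omega
    rw [Fintype.not_linearIndependent_iff] at hdep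
    obtain ⟨c, hc, i, hci⟩ := hdep
    obtain ⟨U, hUT, hU⟩ := exists_pattern_not_realised hℓ T
      (fun j => if h : j ∈ T then c ⟨j, h⟩ else 0)
      (by
        rw [← hc, ← Finset.sum_attach]
        exact Finset.sum_congr rfl fun j _ => by simp) i i.2 (by simpa using hci)
    obtain ⟨u, hu, hTu⟩ := (Finset.mem_shatterer.1 hT) hUT
    obtain ⟨θ, -, rfl⟩ := Finset.mem_image.1 hu
    refine hU θ fun j hj => ?_
    rw [← hTu]
    simp [tr, hj]
  calc S.card = 𝒜.card := hcard
    _ ≤ 𝒜.shatterer.card := Finset.card_le_card_shatterer _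
    _ ≤ ∑ k ∈ Finset.Iic 𝒜.vcDim, (Fintype.card J).choose k :=
      Finset.card_shatterer_le_sum_vcDim
    _ ≤ (Fintype.card J + 1) ^ 𝒜.vcDim := sum_Iic_choose_le_pow _ _
    _ ≤ _ := Nat.pow_le_pow_right (Nat.succ_pos _) hvc

/-! ### Cardinality of L¹-separated sets -/

/-- If every event has probability at least `p`, some `n` points miss at most a proportion
`(1 - p) ^ n` of the events. -/
theorem exists_points_hitting {Y R : Type*} [MeasurableSpace Y] (μ : Measure Y)
    [IsProbabilityMeasure μ] {A : R → Set Y} {p : ℝ} (hp : p ≤ 1) (T : Finset R)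
    (hA : ∀ r ∈ T, MeasurableSet (A r)) (hpA : ∀ r ∈ T, p ≤ μ.real (A r)) (n : ℕ) :
    ∃ (y : Fin n → Y) (T' : Finset R), T' ⊆ T ∧ (∀ r ∈ T, r ∉ T' → ∃ l, y l ∈ A r) ∧
      (T'.card : ℝ) ≤ (1 - p) ^ n * T.card := by
  classical
  induction n with
  | zero => exact ⟨Fin.elim0, T, subset_rfl, fun r h h' => absurd h h', by simp⟩
  | succ n ih =>
    obtain ⟨y, T', hT', hy, hc⟩ := ih
    have hint : ∀ r ∈ T', Integrable ((A r)ᶜ.indicator (fun _ => (1 : ℝ))) μ := fun r hr =>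
      (integrable_const (1 : ℝ)).indicator (hA r (hT' hr)).compl
    -- Averaging: some point misses no more of the remaining events than the mean number missed.
    obtain ⟨z, hz⟩ := exists_le_integral (μ := μ) (integrable_finsetSum T' hint)
    rw [integral_finsetSum T' hint] at hz
    have hle : ∑ r ∈ T', ∫ a, (A r)ᶜ.indicator (fun _ => (1 : ℝ)) a ∂μ ≤
        ∑ r ∈ T', (1 - p) := by
      refine Finset.sum_le_sum fun r hr => ?_
      rw [integral_indicator_const _ (hA r (hT' hr)).compl,
        probReal_compl_eq_one_sub (hA r (hT' hr))]
      rw [smul_eq_mul, mul_one]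
      linarith [hpA r (hT' hr)]
    refine ⟨Fin.cons z y, T'.filter fun r => z ∉ A r, (Finset.filter_subset _ _).trans hT',
      fun r hr hr' => ?_, ?_⟩
    · by_cases h : r ∈ T'
      · refine ⟨0, ?_⟩
        simpa [h] using hr'
      · obtain ⟨l, hl⟩ := hy r hr h
        exact ⟨l.succ, by simpa using hl⟩
    · have e : ((T'.filter fun r => z ∉ A r).card : ℝ) =
          ∑ r ∈ T', (A r)ᶜ.indicator (fun _ => (1 : ℝ)) z := by
        rw [Finset.card_filter]
        push_cast
        refine Finset.sum_congr rfl fun r _ => ?_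
        simp [Set.indicator_apply]
      rw [e]
      refine (hz.trans hle).trans ?_
      rw [Finset.sum_const, nsmul_eq_mul, pow_succ, mul_comm]
      calc (1 - p) * T'.card ≤ (1 - p) * ((1 - p) ^ n * T.card) :=
            mul_le_mul_of_nonneg_left hc (by linarith)
        _ = _ := by ring

/-- Taking n just above 2 log m / p bounds m by the D-th power of a multiple of log m. The logarithm
is absorbed by log m ≤ 2D m^(1/(2D)), at the price of doubling the exponent. -/
theorem le_pow_of_le_log_pow {q D m : ℕ} (hD : 1 ≤ D) (hm : 1 ≤ m) {p : ℝ} (hp : 0 < p)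
    (hp1 : p ≤ 1)
    (h : ∀ n : ℕ, (1 - p) ^ n * (m : ℝ) ^ 2 < 1 → m ≤ (n * q + 1) ^ D) :
    (m : ℝ) ≤ ((4 * D * q + 2 * q + 1) / p) ^ (2 * D) := by
  have hm0 : (0 : ℝ) < m := by exact_mod_cast hm
  have hlog : 0 ≤ Real.log m := Real.log_natCast_nonneg m
  obtain ⟨n, hn1, hn2⟩ : ∃ n : ℕ, 2 * Real.log m / p < n ∧ (n : ℝ) ≤ 2 * Real.log m / p + 1 :=
    ⟨⌊2 * Real.log m / p⌋₊ + 1, by push_cast; exact Nat.lt_floor_add_one _,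
      by push_cast; gcongr; exact Nat.floor_le (by positivity)⟩
  have hmn : m ≤ (n * q + 1) ^ D := by
    refine h n ?_
    have h1 : (1 - p) ^ n ≤ Real.exp (-(p * n)) := by
      calc (1 - p) ^ n ≤ (Real.exp (-p)) ^ n :=
            pow_le_pow_left₀ (by linarith) (Real.one_sub_le_exp_neg p) n
        _ = _ := by rw [← Real.exp_nat_mul]; ring_nf
    have h2 : (m : ℝ) ^ 2 = Real.exp (2 * Real.log m) := by
      rw [mul_comm, Real.exp_mul, Real.exp_log hm0]; norm_cast
    rw [h2]
    calc _ ≤ Real.exp (-(p * n)) * Real.exp (2 * Real.log m) := by gcongr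
      _ = Real.exp (2 * Real.log m - p * n) := by rw [← Real.exp_add]; ring_nf
      _ < 1 := by
        rw [Real.exp_lt_one_iff]
        rw [div_lt_iff₀ hp] at hn1
        linarith
  have hD0 : (0 : ℝ) < D := by exact_mod_cast hD
  set u : ℝ := Real.exp (Real.log m / (2 * D)) with hu
  have hum : u ^ (2 * D) = m := by
    rw [hu, ← Real.exp_nat_mul]
    push_cast
    rw [mul_div_cancel₀ _ (by positivity), Real.exp_log hm0]
  have hu1 : 1 ≤ u := Real.one_le_exp (by positivity)
  have hlogu : Real.log m ≤ 2 * D * u := by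
    have := Real.add_one_le_exp (Real.log m / (2 * D))
    have h3 : Real.log m / (2 * D) ≤ u := by linarith
    rw [div_le_iff₀ (by positivity)] at h3
    linarith
  have hnq : (n : ℝ) * q + 1 ≤ (4 * D * q + 2 * q + 1) / p * u := by
    have hup : 1 ≤ u / p := by rw [le_div_iff₀ hp]; linarith
    have hn3 : (n : ℝ) ≤ (4 * D + 1) * (u / p) := by
      calc (n : ℝ) ≤ 2 * Real.log m / p + 1 := hn2
        _ ≤ 2 * (2 * D * u) / p + u / p := by gcongr
        _ = _ := by ring
    calc (n : ℝ) * q + 1 ≤ (4 * D + 1) * (u / p) * q + u / p := by gcongr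
      _ ≤ (4 * D + 1) * (u / p) * q + u / p + q * (u / p) := by
        have : 0 ≤ (q : ℝ) * (u / p) := by positivity
        linarith
      _ = _ := by ring
  have hfin : u ≤ (4 * D * q + 2 * q + 1) / p := by
    have h4 : (u ^ 2) ^ D ≤ ((4 * D * q + 2 * q + 1) / p * u) ^ D := by
      rw [← pow_mul, hum]
      calc (m : ℝ) ≤ ((n : ℝ) * q + 1) ^ D := by exact_mod_cast hmn
        _ ≤ _ := by gcongr
    have h5 := le_of_pow_le_pow_left₀ (by omega) (by positivity) h4
    rw [sq] at h5
    exact le_of_mul_le_mul_right h5 (by linarith)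
  rw [← hum]
  gcongr

theorem measurableSet_setOf_lt_snd {X : Type*} [MeasurableSpace X] {g g' : X → ℝ}
    (hg : Measurable g) (hg' : Measurable g') :
    MeasurableSet {z : X × ℝ | ¬ (z.2 < g z.1 ↔ z.2 < g' z.1)} := by
  have h1 := measurableSet_lt measurable_snd (hg.comp (measurable_fst (β := ℝ)))
  have h2 := measurableSet_lt measurable_snd (hg'.comp (measurable_fst (β := ℝ)))
  exact (h1.iff h2).compl

/-- The `L¹` distance of two `[0, 1]`-valued functions is at most the measure of the symmetric
difference of their subgraphs. -/
theorem lintegral_abs_sub_le_measure_subgraph {X : Type*} [MeasurableSpace X] (ν : Measure X)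
    {g g' : X → ℝ} (hg : Measurable g) (hg' : Measurable g')
    (h0 : ∀ x, 0 ≤ g x) (h1 : ∀ x, g x ≤ 1) (h0' : ∀ x, 0 ≤ g' x) (h1' : ∀ x, g' x ≤ 1) :
    ∫⁻ x, ENNReal.ofReal |g x - g' x| ∂ν ≤
      (ν.prod ((volume : Measure ℝ).restrict (Set.Icc 0 1)))
        {z : X × ℝ | ¬ (z.2 < g z.1 ↔ z.2 < g' z.1)} := by
  rw [Measure.prod_apply (measurableSet_setOf_lt_snd hg hg')]
  refine lintegral_mono fun x => ?_
  -- A height separates the two strict subgraphs when it is at least the smaller value and below the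
  -- larger, hence the half-open interval.
  have hsub : Set.Ico (min (g x) (g' x)) (max (g x) (g' x)) ⊆
      Prod.mk x ⁻¹' {z : X × ℝ | ¬ (z.2 < g z.1 ↔ z.2 < g' z.1)} := by
    intro s hs
    simp only [Set.mem_Ico, min_le_iff, lt_max_iff] at hs
    simp only [Set.mem_preimage, Set.mem_ofPred_eq]
    grind
  calc ENNReal.ofReal |g x - g' x|
      = volume (Set.Ico (min (g x) (g' x)) (max (g x) (g' x))) := by
        rw [Real.volume_Ico, max_sub_min_eq_abs']
    _ = (volume.restrict (Set.Icc 0 1)) (Set.Ico (min (g x) (g' x)) (max (g x) (g' x))) := by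
        rw [Measure.restrict_apply measurableSet_Ico, Set.inter_eq_left.2]
        intro s hs
        exact ⟨(le_min (h0 x) (h0' x)).trans hs.1, hs.2.le.trans (max_le (h1 x) (h1' x))⟩
    _ ≤ _ := measure_mono hsub

/-- A set of parameters which is `p`-separated in `L¹` has polynomial cardinality in `1 / p`. -/
theorem card_le_of_lintegral_separated {X Θ W κ : Type*} [MeasurableSpace X] [AddCommGroup W]
    [Module ℝ W] [FiniteDimensional ℝ W] [Fintype κ] {w : Θ → W} {g : κ → Θ → X → ℝ}
    (hW : 1 ≤ Module.finrank ℝ W)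
    (hg : ∀ c θ, Measurable (g c θ)) (h0 : ∀ c θ x, 0 ≤ g c θ x) (h1 : ∀ c θ x, g c θ x ≤ 1)
    (hlin : ∀ c x s, IsLinearThreshold w (fun θ => s < g c θ x))
    (ν : Measure X) [IsProbabilityMeasure ν] {p : ℝ} (hp : 0 < p) (hp1 : p ≤ 1) (S : Finset Θ)
    (hS : ∀ θ ∈ S, ∀ θ' ∈ S, θ ≠ θ' →
      ∃ c, ENNReal.ofReal p ≤ ∫⁻ x, ENNReal.ofReal |g c θ x - g c θ' x| ∂ν) :
    (S.card : ℝ) ≤ ((4 * (Module.finrank ℝ W : ℕ) * (Fintype.card κ : ℕ)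
      + 2 * (Fintype.card κ : ℕ) + 1) / p) ^ (2 * Module.finrank ℝ W) := by
  classical
  rcases S.eq_empty_or_nonempty with rfl | hne
  · simp only [Finset.card_empty, Nat.cast_zero]
    positivity
  refine le_pow_of_le_log_pow hW hne.card_pos hp hp1 fun n hn => ?_
  let μ : Measure (X × ℝ) := ν.prod ((volume : Measure ℝ).restrict (Set.Icc 0 1))
  have hprob : IsProbabilityMeasure ((volume : Measure ℝ).restrict (Set.Icc 0 1)) :=
    ⟨by simp⟩
  let A : Θ × Θ → Set (X × ℝ) := fun r =>
    ⋃ c, {z | ¬ (z.2 < g c r.1 z.1 ↔ z.2 < g c r.2 z.1)}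
  have hA : ∀ r, MeasurableSet (A r) := fun r =>
    MeasurableSet.iUnion fun c => measurableSet_setOf_lt_snd (hg c _) (hg c _)
  have hpA : ∀ r ∈ S.offDiag, p ≤ μ.real (A r) := by
    rintro ⟨θ, θ'⟩ hr
    obtain ⟨hθ, hθ', hneq⟩ := Finset.mem_offDiag.1 hr
    obtain ⟨c, hc⟩ := hS θ hθ θ' hθ' hneq
    rw [measureReal_def, ← ENNReal.ofReal_le_iff_le_toReal (measure_ne_top _ _)]
    refine hc.trans ((lintegral_abs_sub_le_measure_subgraph ν (hg c θ) (hg c θ') (h0 c θ) (h1 c θ)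
      (h0 c θ') (h1 c θ')).trans (measure_mono ?_))
    exact Set.subset_iUnion (fun c => {z : X × ℝ | ¬ (z.2 < g c θ z.1 ↔ z.2 < g c θ' z.1)}) c
  obtain ⟨y, T', hT', hy, hcard⟩ :=
    exists_points_hitting μ hp1 S.offDiag (fun r _ => hA r) hpA n
  -- There are at most m² ordered pairs, so fewer than one stays undistinguished.
  have hT'0 : T' = ∅ := by
    rw [← Finset.card_eq_zero, ← Nat.lt_one_iff, ← Nat.cast_lt (α := ℝ), Nat.cast_one]
    refine hcard.trans_lt (lt_of_le_of_lt ?_ hn)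
    have : (S.offDiag.card : ℝ) ≤ (S.card : ℝ) ^ 2 := by
      rw [Finset.offDiag_card, sq]
      exact_mod_cast Nat.sub_le _ _
    exact mul_le_mul_of_nonneg_left this (pow_nonneg (by linarith) n)
  have hmain := card_le_of_isLinearThreshold (w := w) (J := Fin n × κ)
    (P := fun j θ => (y j.1).2 < g j.2 θ (y j.1).1) (fun j => hlin _ _ _) S ?_
  · simpa using hmain
  · intro θ hθ θ' hθ' h
    by_contra hneq
    obtain ⟨l, hl⟩ := hy (θ, θ') (Finset.mem_offDiag.2 ⟨hθ, hθ', hneq⟩) (by simp [hT'0])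
    obtain ⟨c, hc⟩ := Set.mem_iUnion.1 hl
    exact hc (h (l, c))

/-! ### From separated sets to L² covering numbers -/

/-- Covering numbers are at most packing numbers. Finite sets suffice, because a separated set with
more than ⌊B⌋ points contains one with exactly ⌊B⌋ + 1. -/
theorem coveringNumber_le_of_forall_finset {Y : Type*} [PseudoEMetricSpace Y] {s : Set Y}
    {δ : ℝ≥0} {B : ℝ}
    (h : ∀ T : Finset Y, (T : Set Y) ⊆ s → IsSeparated δ (T : Set Y) → (T.card : ℝ) ≤ B) :
    (coveringNumber δ s : ℝ≥0∞) ≤ ENNReal.ofReal B := by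
  have hB : 0 ≤ B := by simpa using h ∅ (by simp) (by simp)
  have hpack : packingNumber δ s ≤ (⌊B⌋₊ : ℕ∞) := by
    refine iSup_le fun C => iSup_le fun hC => iSup_le fun hsep => ?_
    by_contra! hlt
    obtain ⟨T, hTC, hT⟩ := Set.exists_subset_encard_eq (Order.add_one_le_of_lt hlt)
    have hfin : T.Finite := Set.finite_of_encard_eq_coe (k := ⌊B⌋₊ + 1) (by simpa using hT)
    have h1 := h hfin.toFinset (by simpa using hTC.trans hC) (by simpa using hsep.subset hTC)
    have h2 : hfin.toFinset.card = ⌊B⌋₊ + 1 := by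
      rw [hfin.encard_eq_coe_toFinset_card] at hT
      exact_mod_cast hT
    rw [h2] at h1
    push_cast at h1
    exact absurd h1 (not_le.2 (Nat.lt_floor_add_one B))
  have h3 : coveringNumber δ s ≤ (⌊B⌋₊ : ℕ∞) := (coveringNumber_le_packingNumber _ _).trans hpack
  calc (coveringNumber δ s : ℝ≥0∞) ≤ ((⌊B⌋₊ : ℕ∞) : ℝ≥0∞) := ENat.toENNReal_mono h3
    _ = ENNReal.ofReal (⌊B⌋₊ : ℝ) := by simp
    _ ≤ _ := ENNReal.ofReal_le_ofReal (Nat.floor_le hB)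

theorem eLpNorm_two_sq {X : Type*} [MeasurableSpace X] (f : X → ℝ) (Q : Measure X) :
    eLpNorm f 2 Q ^ 2 = ∫⁻ x, ENNReal.ofReal (f x ^ 2) ∂Q := by
  have := eLpNorm_nnreal_pow_eq_lintegral (f := f) (μ := Q) (p := 2) (by norm_num)
  simp only [NNReal.coe_ofNat, ENNReal.coe_ofNat, ENNReal.rpow_ofNat] at this
  rw [this]
  refine lintegral_congr fun x => ?_
  rw [Real.enorm_eq_ofReal_abs, ← ENNReal.ofReal_pow (abs_nonneg _), sq_abs]

/-- The weighted integrals of `|g - g'|` control the `L²` separation; after normalising the weight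
`t ^ 2` to a probability measure, one of them is bounded below. -/
theorem exists_le_lintegral_of_separated {X κ : Type*} [MeasurableSpace X] [Fintype κ]
    {Q : Measure X} {f f' t : X → ℝ} {g g' : κ → X → ℝ} {C e : ℝ} (hC : 0 ≤ C) (he : 0 ≤ e)
    (ht : Measurable t) (hg : ∀ c, Measurable (g c)) (hg' : ∀ c, Measurable (g' c))
    (hf : ∀ x, (f x - f' x) ^ 2 ≤ C * t x ^ 2 * ∑ c, |g c x - g' c x|)
    (hsep : ENNReal.ofReal e * ∫⁻ x, ENNReal.ofReal (t x ^ 2) ∂Q < eLpNorm (f - f') 2 Q ^ 2)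
    (hI : ∫⁻ x, ENNReal.ofReal (t x ^ 2) ∂Q ≠ ⊤) :
    ∃ c, ENNReal.ofReal (e / (C * Fintype.card κ + 1)) ≤
      ∫⁻ x, ENNReal.ofReal |g c x - g' c x| ∂((∫⁻ x, ENNReal.ofReal (t x ^ 2) ∂Q)⁻¹ •
        Q.withDensity fun x => ENNReal.ofReal (t x ^ 2)) := by
  set I := ∫⁻ x, ENNReal.ofReal (t x ^ 2) ∂Q with hIdef
  have ht2 : Measurable fun x => ENNReal.ofReal (t x ^ 2) := (ht.pow_const 2).ennreal_ofReal
  have hgm : ∀ c, Measurable fun x => ENNReal.ofReal |g c x - g' c x| := fun c =>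
    ((hg c).sub (hg' c)).abs.ennreal_ofReal
  let J : κ → ℝ≥0∞ := fun c =>
    ∫⁻ x, ENNReal.ofReal (t x ^ 2) * ENNReal.ofReal |g c x - g' c x| ∂Q
  have hJ : ∀ c, ∫⁻ x, ENNReal.ofReal |g c x - g' c x| ∂(I⁻¹ •
        Q.withDensity fun x => ENNReal.ofReal (t x ^ 2)) = I⁻¹ * J c := by
    intro c
    rw [lintegral_smul_measure, lintegral_withDensity_eq_lintegral_mul _ ht2 (hgm c)]
    rfl
  have hle : eLpNorm (f - f') 2 Q ^ 2 ≤ ENNReal.ofReal C * ∑ c, J c := by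
    have hm : ∀ c ∈ Finset.univ, Measurable fun x =>
        ENNReal.ofReal (t x ^ 2) * ENNReal.ofReal |g c x - g' c x| := fun c _ => ht2.mul (hgm c)
    rw [eLpNorm_two_sq, ← lintegral_finsetSum _ hm,
      ← lintegral_const_mul _ (Finset.measurable_fun_sum _ hm)]
    refine lintegral_mono fun x => ?_
    rw [← Finset.mul_sum, ← ENNReal.ofReal_sum_of_nonneg fun c _ => abs_nonneg _,
      ← ENNReal.ofReal_mul (sq_nonneg _), ← ENNReal.ofReal_mul hC, ← mul_assoc]
    exact ENNReal.ofReal_le_ofReal (hf x)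
  by_contra! hcon
  refine absurd (hsep.trans_le hle) (not_lt.2 ?_)
  -- Normalisation fails when the weight has no mass, but then all `J c` vanish.
  rcases eq_or_ne I 0 with hI0 | hI0
  · have : ∀ c, J c = 0 := by
      intro c
      rw [hIdef, lintegral_eq_zero_iff ht2] at hI0
      refine (lintegral_eq_zero_iff (ht2.mul (hgm c))).2 ?_
      filter_upwards [hI0] with x hx
      simp only [Pi.zero_apply] at hx
      simp [hx]
    simp [this]
  have hJle : ∀ c, J c ≤ I * ENNReal.ofReal (e / (C * Fintype.card κ + 1)) := by
    intro c
    have := (hcon c).le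
    rw [hJ c, mul_comm, ← div_eq_mul_inv] at this
    rw [mul_comm]
    exact (ENNReal.div_le_iff_le_mul (Or.inl hI0) (Or.inl hI)).1 this
  calc ENNReal.ofReal C * ∑ c, J c
      ≤ ENNReal.ofReal C * ∑ _c : κ, I * ENNReal.ofReal (e / (C * Fintype.card κ + 1)) := by
        gcongr with c; exact hJle c
    _ = ENNReal.ofReal (C * Fintype.card κ * (e / (C * Fintype.card κ + 1))) * I := by
        rw [Finset.sum_const, Finset.card_univ, nsmul_eq_mul, ENNReal.ofReal_mul (by positivity),
          ENNReal.ofReal_mul hC, ENNReal.ofReal_natCast]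
        ring
    -- The `+ 1` only keeps the denominator positive when `C` or the cardinality is zero.
    _ ≤ ENNReal.ofReal e * I := by
        gcongr
        rw [← mul_div_assoc, div_le_iff₀ (by positivity)]
        nlinarith

theorem isProbabilityMeasure_smul_withDensity {X : Type*} [MeasurableSpace X] {Q : Measure X}
    {f : X → ℝ≥0∞} (h0 : ∫⁻ x, f x ∂Q ≠ 0) (h1 : ∫⁻ x, f x ∂Q ≠ ⊤) :
    IsProbabilityMeasure ((∫⁻ x, f x ∂Q)⁻¹ • Q.withDensity f) := by
  refine ⟨?_⟩
  rw [Measure.smul_apply, withDensity_apply _ MeasurableSet.univ, Measure.restrict_univ,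
    smul_eq_mul, ENNReal.inv_mul_cancel h0 h1]

/-- Polynomial `L²` covering numbers for a class of functions whose increments are controlled by
finitely many families of `[0, 1]`-valued functions with linear threshold level sets. -/
theorem exists_coveringNumber_le {X Θ W κ : Type*} [MeasurableSpace X] [AddCommGroup W]
    [Module ℝ W] [FiniteDimensional ℝ W] [Fintype κ] {w : Θ → W} {g : κ → Θ → X → ℝ}
    (hW : 1 ≤ Module.finrank ℝ W)
    (hg : ∀ c θ, Measurable (g c θ)) (h0 : ∀ c θ x, 0 ≤ g c θ x) (h1 : ∀ c θ x, g c θ x ≤ 1)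
    (hlin : ∀ c x s, IsLinearThreshold w (fun θ => s < g c θ x))
    {f : Θ → X → ℝ} {t F : X → ℝ} {C : ℝ} (hC : 0 ≤ C) (ht : Measurable t)
    (htF : ∀ x, |t x| ≤ F x)
    (hf : ∀ θ θ' x, (f θ x - f θ' x) ^ 2 ≤ C * t x ^ 2 * ∑ c, |g c θ x - g c θ' x|) :
    ∃ A v : ℝ, 0 < A ∧ 0 < v ∧
      ∀ Q : Measure X, IsProbabilityMeasure Q → MemLp F 2 Q →
        ∀ ε : ℝ≥0, 0 < ε → ε < 1 →
          (coveringNumber (ε * (eLpNorm F 2 Q).toNNReal) (l2Class (Set.range f) Q) : ℝ≥0∞) ≤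
            ENNReal.ofReal ((A / (ε : ℝ)) ^ v) := by
  classical
  set D := Module.finrank ℝ W
  set q := Fintype.card κ
  set G : ℝ := 4 * D * q + 2 * q + 1 with hG
  have hG1 : 1 ≤ G := by rw [hG]; linarith [show (0 : ℝ) ≤ 4 * D * q + 2 * q by positivity]
  have hCq : 1 ≤ C * q + 1 := by linarith [show 0 ≤ C * q by positivity]
  have hA1 : 1 ≤ G * (C * q + 1) := one_le_mul_of_one_le_of_one_le hG1 hCq
  -- The exponent `2 * D` of the L¹ count is doubled because the L¹ separation is of order ε².
  refine ⟨G * (C * q + 1), ((2 * (2 * D) : ℕ) : ℝ), by linarith, by positivity,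
    fun Q hQ hF ε hε hε1 => ?_⟩
  rw [Real.rpow_natCast]
  have hε0 : (0 : ℝ) < ε := by exact_mod_cast hε
  have hε1' : (ε : ℝ) < 1 := by exact_mod_cast hε1
  refine coveringNumber_le_of_forall_finset fun T hT hsep => ?_
  -- A separated pair is what later excludes a weight of zero mass, so sets with at most one point
  -- are treated apart.
  rcases le_or_gt T.card 1 with hT1 | hT1
  · have : 1 ≤ G * (C * q + 1) / (ε : ℝ) := by rw [le_div_iff₀ hε0]; linarith
    exact le_trans (by exact_mod_cast hT1) (one_le_pow₀ this)
  obtain ⟨a, ha, b, hb, hab⟩ := Finset.one_lt_card.1 hT1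
  have : Nonempty Θ := by
    obtain ⟨_, ⟨θ, -⟩, -⟩ := hT ha
    exact ⟨θ⟩
  have hex : ∀ u ∈ T, ∃ θ, u =ᵐ[Q] f θ := by
    intro u hu
    obtain ⟨_, ⟨θ, rfl⟩, h⟩ := hT hu
    exact ⟨θ, h⟩
  choose! θ hθ using hex
  have hinj : Set.InjOn θ T := fun u hu u' hu' h =>
    Lp.ext ((hθ u hu).trans (h ▸ (hθ u' hu').symm))
  set I := ∫⁻ x, ENNReal.ofReal (t x ^ 2) ∂Q with hI
  have hIF : I ≤ eLpNorm F 2 Q ^ 2 := by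
    rw [eLpNorm_two_sq]
    exact lintegral_mono fun x => ENNReal.ofReal_le_ofReal
      (sq_le_sq.2 ((htF x).trans (le_abs_self _)))
  have hItop : I ≠ ⊤ := ne_top_of_le_ne_top (ENNReal.pow_ne_top hF.eLpNorm_ne_top) hIF
  have hsep' : ∀ u ∈ T, ∀ u' ∈ T, u ≠ u' →
      ENNReal.ofReal ((ε : ℝ) ^ 2) * I < eLpNorm (f (θ u) - f (θ u')) 2 Q ^ 2 := by
    intro u hu u' hu' hne
    have h := hsep hu hu' hne
    beta_reduce at h
    rw [Lp.edist_def, eLpNorm_congr_ae ((hθ u hu).sub (hθ u' hu')), ENNReal.coe_mul,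
      ENNReal.coe_toNNReal hF.eLpNorm_ne_top] at h
    calc ENNReal.ofReal ((ε : ℝ) ^ 2) * I ≤ (ε : ℝ≥0∞) ^ 2 * eLpNorm F 2 Q ^ 2 := by
          rw [ENNReal.ofReal_pow hε0.le, ENNReal.ofReal_coe_nnreal]
          gcongr
      _ = (ε * eLpNorm F 2 Q) ^ 2 := (mul_pow _ _ _).symm
      _ < _ := ENNReal.pow_lt_pow_left two_ne_zero h
  have hint : ∀ u ∈ T, ∀ u' ∈ T, u ≠ u' → _ := fun u hu u' hu' hne =>
    exists_le_lintegral_of_separated hC (sq_nonneg (ε : ℝ)) ht (fun c => hg c (θ u))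
      (fun c => hg c (θ u')) (hf (θ u) (θ u')) (hsep' u hu u' hu' hne) hItop
  have hI0 : I ≠ 0 := by
    intro hI0
    obtain ⟨c, hc⟩ := hint a ha b hb hab
    have hz : (Q.withDensity fun x => ENNReal.ofReal (t x ^ 2)) = 0 := by
      rw [withDensity_eq_zero_iff (ht.pow_const 2).ennreal_ofReal.aemeasurable]
      exact (lintegral_eq_zero_iff (ht.pow_const 2).ennreal_ofReal).1 hI0
    rw [hz, smul_zero, lintegral_zero_measure, nonpos_iff_eq_zero, ENNReal.ofReal_eq_zero] at hc
    exact absurd hc (not_le.2 (by positivity))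
  have hprob := isProbabilityMeasure_smul_withDensity hI0 hItop
  have hp1 : (ε : ℝ) ^ 2 / (C * q + 1) ≤ 1 := by
    rw [div_le_one (by positivity)]
    nlinarith
  have hmain := card_le_of_lintegral_separated hW hg h0 h1 hlin _
    (p := (ε : ℝ) ^ 2 / (C * q + 1)) (by positivity) hp1 (T.image θ) (by
      intro θ₁ h₁ θ₂ h₂ hne
      obtain ⟨u, hu, rfl⟩ := Finset.mem_image.1 h₁
      obtain ⟨u', hu', rfl⟩ := Finset.mem_image.1 h₂
      exact hint u hu u' hu' fun h => hne (h ▸ rfl))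
  rw [Finset.card_image_of_injOn hinj] at hmain
  have hbase : G / ((ε : ℝ) ^ 2 / (C * q + 1)) ≤ (G * (C * q + 1) / ε) ^ 2 := by
    rw [div_div_eq_mul_div, div_pow]
    gcongr
    nlinarith
  calc (T.card : ℝ) ≤ (G / ((ε : ℝ) ^ 2 / (C * q + 1))) ^ (2 * D) := hmain
    _ ≤ ((G * (C * q + 1) / ε) ^ 2) ^ (2 * D) := pow_le_pow_left₀ (by positivity) hbase _
    _ = (G * (C * q + 1) / ε) ^ (2 * (2 * D)) := (pow_mul _ _ _).symm

/-! ### Linear forms and monotone functions of their ratios -/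

/-- `a` is a linear form in the parameter `w θ`. -/
def IsLinearIn {Θ W : Type*} [AddCommGroup W] [Module ℝ W] (w : Θ → W) (a : Θ → ℝ) : Prop :=
  ∃ ℓ : Module.Dual ℝ W, ∀ θ, a θ = ℓ (w θ)

section LinearIn

variable {Θ W : Type*} [AddCommGroup W] [Module ℝ W] {w : Θ → W} {a b : Θ → ℝ}

theorem IsLinearIn.add (ha : IsLinearIn w a) (hb : IsLinearIn w b) :
    IsLinearIn w fun θ => a θ + b θ := by
  obtain ⟨ℓ, h⟩ := ha
  obtain ⟨ℓ', h'⟩ := hb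
  exact ⟨ℓ + ℓ', fun θ => by simp [h, h']⟩

theorem IsLinearIn.const_mul (ha : IsLinearIn w a) (r : ℝ) : IsLinearIn w fun θ => r * a θ := by
  obtain ⟨ℓ, h⟩ := ha
  exact ⟨r • ℓ, fun θ => by simp [h]⟩

/-- Superlevel sets of a monotone function are upper sets. Both kinds of half-line occur, which is
why thresholds may be strict or weak. -/
theorem isUpperSet_real_cases {U : Set ℝ} (hU : IsUpperSet U) :
    U = ∅ ∨ U = Set.univ ∨ (∃ r, U = Set.Ioi r) ∨ ∃ r, U = Set.Ici r := by
  rcases U.eq_empty_or_nonempty with h | hne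
  · exact Or.inl h
  by_cases hbd : BddBelow U
  · right; right
    have hlt : ∀ x, sInf U < x → x ∈ U := fun x hx => by
      obtain ⟨y, hy, hyx⟩ := (csInf_lt_iff hbd hne).1 hx
      exact hU hyx.le hy
    by_cases hm : sInf U ∈ U
    · exact Or.inr ⟨sInf U, Set.Subset.antisymm (fun x hx => csInf_le hbd hx)
        fun x hx => hU hx hm⟩
    · refine Or.inl ⟨sInf U, Set.Subset.antisymm (fun x hx => ?_) hlt⟩
      exact lt_of_le_of_ne (csInf_le hbd hx) fun h => hm (h ▸ hx)
  · refine Or.inr (Or.inl (Set.eq_univ_of_forall fun x => ?_))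
    rw [not_bddBelow_iff] at hbd
    obtain ⟨y, hy, hyx⟩ := hbd x
    exact hU hyx.le hy

/-- The superlevel sets of a monotone function of a ratio of linear forms are linear thresholds. -/
theorem isLinearThreshold_lt_monotone_div (ha : IsLinearIn w a) (hb : IsLinearIn w b)
    (hpos : ∀ θ, 0 < b θ) {φ : ℝ → ℝ} (hφ : Monotone φ) (s : ℝ) :
    IsLinearThreshold w fun θ => s < φ (a θ / b θ) := by
  have hU : IsUpperSet {u | s < φ u} := fun u v huv hu => lt_of_lt_of_le hu (hφ huv)
  have hmem : ∀ {U : Set ℝ}, {u | s < φ u} = U → ∀ u, (s < φ u ↔ u ∈ U) := by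
    rintro _ rfl u
    rfl
  rcases isUpperSet_real_cases hU with h | h | ⟨r, h⟩ | ⟨r, h⟩
  -- The zero functional yields the empty event from the strict inequality and the full event from
  -- the weak one.
  · exact ⟨0, Or.inl fun θ => by simp [hmem h]⟩
  · exact ⟨0, Or.inr fun θ => by simp [hmem h]⟩
  · obtain ⟨ℓ, hℓ⟩ := ha.add (hb.const_mul (-r))
    refine ⟨ℓ, Or.inl fun θ => ?_⟩
    beta_reduce
    rw [hmem h, ← hℓ, Set.mem_Ioi, lt_div_iff₀ (hpos θ)]
    constructor <;> intro <;> linarith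
  · obtain ⟨ℓ, hℓ⟩ := ha.add (hb.const_mul (-r))
    refine ⟨ℓ, Or.inr fun θ => ?_⟩
    beta_reduce
    rw [hmem h, ← hℓ, Set.mem_Ici, le_div_iff₀ (hpos θ)]
    constructor <;> intro <;> linarith

end LinearIn

/-! ### Increments of functions of bounded variation and of products -/

/-- A function of bounded variation is controlled by a monotone function into `[0, 1]`. -/
theorem exists_monotone_abs_sub_le {f : ℝ → ℝ} (hf : BoundedVariationOn f Set.univ) :
    ∃ (φ : ℝ → ℝ) (L : ℝ), 0 ≤ L ∧ Monotone φ ∧ (∀ u, 0 ≤ φ u) ∧ (∀ u, φ u ≤ 1) ∧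
      ∀ u v, |f u - f v| ≤ L * |φ u - φ v| := by
  set T := (eVariationOn f Set.univ).toReal
  have hT0 : 0 ≤ T := ENNReal.toReal_nonneg
  have hfin : ∀ s, eVariationOn f s ≠ ⊤ := fun s => hf.mono (Set.subset_univ s)
  have hmono : ∀ {u v : ℝ}, u ≤ v →
      (eVariationOn f (Set.Iic u)).toReal + |f u - f v| ≤ (eVariationOn f (Set.Iic v)).toReal := by
    intro u v huv
    have h1 : eVariationOn f (Set.Iic u) + eVariationOn f (Set.Icc u v) ≤
        eVariationOn f (Set.Iic v) := by
      refine (eVariationOn.add_le_union f fun x hx y hy => hx.trans hy.1).trans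
        (eVariationOn.mono f ?_)
      exact Set.union_subset (Set.Iic_subset_Iic.2 huv) Set.Icc_subset_Iic_self
    have h2 : |f u - f v| ≤ (eVariationOn f (Set.Icc u v)).toReal := by
      rw [← Real.dist_eq]
      exact (hf.mono (Set.subset_univ _)).dist_le (Set.left_mem_Icc.2 huv)
        (Set.right_mem_Icc.2 huv)
    have h3 := ENNReal.toReal_mono (hfin _) h1
    rw [ENNReal.toReal_add (hfin _) (hfin _)] at h3
    linarith
  -- The witness is the variation up to `u`, rescaled into [0, 1]; `T + 1` avoids division by zero
  -- for constant `f`.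
  refine ⟨fun u => (eVariationOn f (Set.Iic u)).toReal / (T + 1), T + 1, by linarith, ?_, ?_, ?_, ?_⟩
  · intro u v huv
    have := hmono huv
    have h0 := abs_nonneg (f u - f v)
    exact div_le_div_of_nonneg_right (by linarith) (by linarith)
  · intro u
    positivity
  · intro u
    rw [div_le_one (by linarith)]
    have := ENNReal.toReal_mono (hfin _) (eVariationOn.mono f (Set.subset_univ (Set.Iic u)))
    linarith
  · intro u v
    rw [← sub_div, abs_div, abs_of_pos (show 0 < T + 1 by linarith),
      mul_div_cancel₀ _ (by linarith)]
    rcases le_total u v with h | h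
    · rw [abs_sub_comm (ENNReal.toReal _)]
      exact le_trans (by linarith [hmono h]) (le_abs_self _)
    · rw [abs_sub_comm (f u)]
      exact le_trans (by linarith [hmono h]) (le_abs_self _)

theorem BoundedVariationOn.measurable_of_univ {f : ℝ → ℝ} (hf : BoundedVariationOn f Set.univ) :
    Measurable f := by
  obtain ⟨p, q, hp, hq, rfl⟩ := hf.locallyBoundedVariationOn.exists_monotoneOn_sub_monotoneOn
  exact (monotoneOn_univ.1 hp).measurable.sub (monotoneOn_univ.1 hq).measurable

/-- Factors are exchanged one at a time; `1 ≤ B` lets the partial products be bounded by a common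
power. -/
theorem abs_prod_sub_prod_le {ι : Type*} (s : Finset ι) {a b : ι → ℝ} {B : ℝ} (hB : 1 ≤ B)
    (ha : ∀ i, |a i| ≤ B) (hb : ∀ i, |b i| ≤ B) :
    |∏ i ∈ s, a i - ∏ i ∈ s, b i| ≤ B ^ s.card * ∑ i ∈ s, |a i - b i| := by
  classical
  induction s using Finset.induction_on with
  | empty => simp
  | insert i s hi ih =>
    have hB0 : 0 ≤ B := by linarith
    have hP : |∏ j ∈ s, a j| ≤ B ^ s.card := by
      rw [Finset.abs_prod]
      exact (Finset.prod_le_prod (fun j _ => abs_nonneg _) fun j _ => ha j).trans_eq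
        (Finset.prod_const B)
    rw [Finset.prod_insert hi, Finset.prod_insert hi, Finset.sum_insert hi,
      Finset.card_insert_of_notMem hi, pow_succ]
    calc |a i * ∏ j ∈ s, a j - b i * ∏ j ∈ s, b j|
        = |(a i - b i) * ∏ j ∈ s, a j + b i * (∏ j ∈ s, a j - ∏ j ∈ s, b j)| := by ring_nf
      _ ≤ |a i - b i| * |∏ j ∈ s, a j| + |b i| * |∏ j ∈ s, a j - ∏ j ∈ s, b j| := by
        rw [← abs_mul, ← abs_mul]
        exact abs_add_le _ _
      _ ≤ |a i - b i| * (B ^ s.card * B) + B * (B ^ s.card * ∑ i ∈ s, |a i - b i|) := by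
        gcongr
        · exact hP.trans (le_mul_of_one_le_right (by positivity) hB)
        · exact hb i
      _ = _ := by ring

/-! ### The truncated kernel class -/

/-- Location, bandwidth and truncation level of a truncated kernel function. -/
abbrev KernelParam (d : ℕ) : Type := {θ : EuclideanSpace ℝ (Fin d) × ℝ × ℝ // 0 < θ.2.1}

namespace KernelParam

variable {d : ℕ}

/-- The monomials of the parameters that enter the threshold events linearly. -/
noncomputable def feature (θ : KernelParam d) :
    EuclideanSpace ℝ (Fin d) × ℝ × ℝ × ℝ × ℝ × ℝ :=
  (θ.1.1, ‖θ.1.1‖ ^ 2, θ.1.2.1, θ.1.2.1 ^ 2, θ.1.2.2, 1)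

theorem isLinearIn_inner (x : EuclideanSpace ℝ (Fin d)) :
    IsLinearIn feature fun θ : KernelParam d => inner ℝ x θ.1.1 :=
  ⟨(innerₛₗ ℝ x).comp (LinearMap.fst ℝ _ _), fun _ => rfl⟩

theorem isLinearIn_coord (k : Fin d) :
    IsLinearIn feature fun θ : KernelParam d => θ.1.1 k :=
  ⟨(EuclideanSpace.proj (𝕜 := ℝ) k).toLinearMap.comp (LinearMap.fst ℝ _ _), fun _ => rfl⟩

theorem isLinearIn_norm_sq : IsLinearIn feature fun θ : KernelParam d => ‖θ.1.1‖ ^ 2 :=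
  ⟨LinearMap.fst ℝ _ _ ∘ₗ LinearMap.snd ℝ _ _, fun _ => rfl⟩

theorem isLinearIn_bandwidth : IsLinearIn feature fun θ : KernelParam d => θ.1.2.1 :=
  ⟨LinearMap.fst ℝ _ _ ∘ₗ LinearMap.snd ℝ _ _ ∘ₗ LinearMap.snd ℝ _ _, fun _ => rfl⟩

theorem isLinearIn_bandwidth_sq : IsLinearIn feature fun θ : KernelParam d => θ.1.2.1 ^ 2 :=
  ⟨LinearMap.fst ℝ _ _ ∘ₗ LinearMap.snd ℝ _ _ ∘ₗ LinearMap.snd ℝ _ _ ∘ₗ LinearMap.snd ℝ _ _,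
    fun _ => rfl⟩

theorem isLinearIn_level : IsLinearIn feature fun θ : KernelParam d => θ.1.2.2 :=
  ⟨LinearMap.fst ℝ _ _ ∘ₗ LinearMap.snd ℝ _ _ ∘ₗ LinearMap.snd ℝ _ _ ∘ₗ LinearMap.snd ℝ _ _ ∘ₗ
    LinearMap.snd ℝ _ _, fun _ => rfl⟩

theorem isLinearIn_one : IsLinearIn feature fun _ : KernelParam d => (1 : ℝ) :=
  ⟨LinearMap.snd ℝ _ _ ∘ₗ LinearMap.snd ℝ _ _ ∘ₗ LinearMap.snd ℝ _ _ ∘ₗ LinearMap.snd ℝ _ _ ∘ₗ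
    LinearMap.snd ℝ _ _, fun _ => rfl⟩

theorem isLinearIn_const (r : ℝ) : IsLinearIn feature fun _ : KernelParam d => r := by
  simpa using isLinearIn_one.const_mul r

end KernelParam

theorem monotone_indicator_Ici_one :
    Monotone ((Set.Ici (0 : ℝ)).indicator fun _ => (1 : ℝ)) := by
  intro u v huv
  simp only [Set.indicator_apply, Set.mem_Ici]
  split_ifs <;> linarith

/-- The truncated kernel class is VC as soon as the increments of the kernel are controlled by
monotone functions of ratios of linear forms in the features of the parameters. -/
theorem isVCClassWithEnvelope_of_increments {d : ℕ} {κ : Type*} [Fintype κ]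
    {K : EuclideanSpace ℝ (Fin d) → ℝ} (hKm : Measurable K) {B L : ℝ} (hB : ∀ x, |K x| ≤ B)
    (hL : 0 ≤ L) {φ : κ → ℝ → ℝ} (hφ : ∀ k, Monotone (φ k)) (hφ0 : ∀ k u, 0 ≤ φ k u)
    (hφ1 : ∀ k u, φ k u ≤ 1) {a : κ → EuclideanSpace ℝ (Fin d) → KernelParam d → ℝ}
    {b : KernelParam d → ℝ} (ham : ∀ k θ, Measurable fun x => a k x θ)
    (ha : ∀ k x, IsLinearIn KernelParam.feature (a k x))
    (hb : IsLinearIn KernelParam.feature b) (hbpos : ∀ θ, 0 < b θ)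
    (hK : ∀ θ θ' : KernelParam d, ∀ x,
      |K (θ.1.2.1⁻¹ • (θ.1.1 - x)) - K (θ'.1.2.1⁻¹ • (θ'.1.1 - x))| ≤
        L * ∑ k, |φ k (a k x θ / b θ) - φ k (a k x θ' / b θ')|) :
    IsVCClassWithEnvelope (truncatedKernelClass K)
      (fun p => 2 * (max 1 (kernelSup K) * |p.1| + max 1 |p.1| * kernelSup K)) := by
  have hbdd : BddAbove (Set.range fun x => |K x|) := ⟨B, by rintro _ ⟨x, rfl⟩; exact hB x⟩
  have hsup : ∀ x, |K x| ≤ kernelSup K := fun x => le_ciSup hbdd x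
  have hsup0 : 0 ≤ kernelSup K := (abs_nonneg _).trans (hsup 0)
  have hB0 : 0 ≤ B := (abs_nonneg _).trans (hB 0)
  let f : KernelParam d → ℝ × EuclideanSpace ℝ (Fin d) → ℝ := fun θ p =>
    p.1 * (Set.Iic θ.1.2.2).indicator (fun _ => (1 : ℝ)) p.1 * K (θ.1.2.1⁻¹ • (θ.1.1 - p.2))
  have hclass : truncatedKernelClass K = Set.range f := by
    ext u
    constructor
    · rintro ⟨y, h, M, hh, rfl⟩
      exact ⟨⟨(y, h, M), hh⟩, rfl⟩
    · rintro ⟨θ, rfl⟩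
      exact ⟨θ.1.1, θ.1.2.1, θ.1.2.2, θ.2, rfl⟩
  -- The first bound makes |t| an admissible weight; the second is the envelope property.
  have hF : ∀ p : ℝ × EuclideanSpace ℝ (Fin d),
      |p.1| ≤ 2 * (max 1 (kernelSup K) * |p.1| + max 1 |p.1| * kernelSup K) ∧
      |p.1| * kernelSup K ≤ 2 * (max 1 (kernelSup K) * |p.1| + max 1 |p.1| * kernelSup K) := by
    intro p
    have h0 := abs_nonneg p.1
    have h1 : 1 * |p.1| ≤ max 1 (kernelSup K) * |p.1| :=
      mul_le_mul_of_nonneg_right (le_max_left _ _) h0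
    have h2 : |p.1| * kernelSup K ≤ max 1 |p.1| * kernelSup K :=
      mul_le_mul_of_nonneg_right (le_max_right _ _) hsup0
    have h3 : 0 ≤ |p.1| * kernelSup K := mul_nonneg h0 hsup0
    constructor <;> linarith
  -- This puts the truncation in the form of a monotone function of a ratio of linear forms.
  have hind : ∀ (M t : ℝ), (Set.Iic M).indicator (fun _ => (1 : ℝ)) t =
      (Set.Ici (0 : ℝ)).indicator (fun _ => (1 : ℝ)) ((M + -t) / 1) := by
    intro M t
    simp [Set.indicator_apply, ← sub_eq_add_neg]
  have hi01 : ∀ (M t : ℝ), 0 ≤ (Set.Iic M).indicator (fun _ => (1 : ℝ)) t ∧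
      (Set.Iic M).indicator (fun _ => (1 : ℝ)) t ≤ 1 := by
    intro M t
    by_cases h : t ∈ Set.Iic M <;> simp [h]
  refine ⟨?_, ?_, ?_, ?_⟩
  · rw [hclass]
    rintro _ ⟨θ, rfl⟩
    refine (measurable_fst.mul ((measurable_const.indicator measurableSet_Iic).comp
      measurable_fst)).mul (hKm.comp ?_)
    fun_prop
  · fun_prop
  · rw [hclass]
    rintro _ ⟨θ, rfl⟩ p
    refine le_trans ?_ (hF p).2
    simp only [f, abs_mul]
    rw [abs_of_nonneg (hi01 _ _).1]
    refine mul_le_mul ?_ (hsup _) (abs_nonneg _) (abs_nonneg _)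
    exact mul_le_of_le_one_right (abs_nonneg _) (hi01 _ _).2
  rw [hclass]
  refine exists_coveringNumber_le (κ := Option κ) (w := KernelParam.feature)
    (t := fun p => p.1) (C := 2 * B * (B + L))
    (g := fun c θ p => c.elim ((Set.Iic θ.1.2.2).indicator (fun _ => (1 : ℝ)) p.1)
      fun k => φ k (a k p.2 θ / b θ)) ?_ ?_ ?_ ?_ ?_ (by positivity) measurable_fst
      (fun p => (hF p).1) ?_
  · simp
  · rintro (_ | k) θ
    · exact (measurable_const.indicator measurableSet_Iic).comp measurable_fst
    · exact (hφ k).measurable.comp (((ham k θ).comp measurable_snd).div_const _)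
  · rintro (_ | k) θ p
    · exact (hi01 _ _).1
    · exact hφ0 _ _
  · rintro (_ | k) θ p
    · exact (hi01 _ _).2
    · exact hφ1 _ _
  · rintro (_ | k) p s
    · simp only [Option.elim_none, hind]
      exact isLinearThreshold_lt_monotone_div
        (KernelParam.isLinearIn_level.add (KernelParam.isLinearIn_const _))
        KernelParam.isLinearIn_one (fun _ => one_pos) monotone_indicator_Ici_one s
    · exact isLinearThreshold_lt_monotone_div (ha k p.2) hb hbpos (hφ k) s
  · intro θ θ' p
    rw [Fintype.sum_option]
    simp only [Option.elim_none, Option.elim_some, f]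
    have hKp := hK θ θ' p.2
    have hb1 := hB (θ.1.2.1⁻¹ • (θ.1.1 - p.2))
    have hb2 := hB (θ'.1.2.1⁻¹ • (θ'.1.1 - p.2))
    obtain ⟨hi0, hi1⟩ := hi01 θ.1.2.2 p.1
    obtain ⟨hj0, hj1⟩ := hi01 θ'.1.2.2 p.1
    generalize (Set.Iic θ.1.2.2).indicator (fun _ => (1 : ℝ)) p.1 = i at *
    generalize (Set.Iic θ'.1.2.2).indicator (fun _ => (1 : ℝ)) p.1 = j at *
    generalize K (θ.1.2.1⁻¹ • (θ.1.1 - p.2)) = u at *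
    generalize K (θ'.1.2.1⁻¹ • (θ'.1.1 - p.2)) = v at *
    have hσ : 0 ≤ ∑ k, |φ k (a k p.2 θ / b θ) - φ k (a k p.2 θ' / b θ')| :=
      Finset.sum_nonneg fun _ _ => abs_nonneg _
    generalize ∑ k, |φ k (a k p.2 θ / b θ) - φ k (a k p.2 θ' / b θ')| = σ at *
    have e1 : |i * u - j * v| ≤ (B + L) * (|i - j| + σ) := by
      calc |i * u - j * v| = |(i - j) * u + j * (u - v)| := by ring_nf
        _ ≤ |i - j| * |u| + |j| * |u - v| := by
          rw [← abs_mul, ← abs_mul]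
          exact abs_add_le _ _
        _ ≤ |i - j| * B + 1 * (L * σ) := by
          gcongr
          rwa [abs_of_nonneg hj0]
        _ ≤ _ := by nlinarith [mul_nonneg hL (abs_nonneg (i - j)), mul_nonneg hB0 hσ]
    have e2 : |i * u - j * v| ≤ 2 * B := by
      calc |i * u - j * v| ≤ |i| * |u| + |j| * |v| := by
            rw [← abs_mul, ← abs_mul]
            exact abs_sub _ _
        _ ≤ 1 * B + 1 * B := by
          gcongr
          · rwa [abs_of_nonneg hi0]
          · rwa [abs_of_nonneg hj0]
        _ = _ := by ring
    -- One factor of the square is bounded by `2 * B`, the other by the increments, giving `C = 2 *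
    -- B * (B + L)`.
    calc (p.1 * i * u - p.1 * j * v) ^ 2
        = p.1 ^ 2 * (|i * u - j * v| * |i * u - j * v|) := by rw [abs_mul_abs_self]; ring
      _ ≤ p.1 ^ 2 * (2 * B * ((B + L) * (|i - j| + σ))) := by gcongr
      _ = _ := by ring

theorem proposition3 (d : ℕ) (K₀ : ℝ → ℝ) (K : EuclideanSpace ℝ (Fin d) → ℝ)
    (hbdd : ∃ C : ℝ, ∀ u, |K₀ u| ≤ C) (hbv : BoundedVariationOn K₀ Set.univ)
    (hK : IsRadialKernel K₀ K ∨ IsProductKernel K₀ K) :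
    IsVCClassWithEnvelope (truncatedKernelClass K)
      (fun p => 2 * (max 1 (kernelSup K) * |p.1| + max 1 |p.1| * kernelSup K)) := by
  obtain ⟨C, hC⟩ := hbdd
  obtain ⟨φ, L, hL, hφ, hφ0, hφ1, hφL⟩ := exists_monotone_abs_sub_le hbv
  have hK₀m := hbv.measurable_of_univ
  rcases hK with hK | hK
  · have hKm : Measurable K := by
      rw [show K = fun x => K₀ ‖x‖ from funext hK]
      exact hK₀m.comp measurable_norm
    -- Only the squared norm is linear in the features, so the square root is composed with φ, which
    -- stays monotone.
    refine isVCClassWithEnvelope_of_increments (κ := Unit) hKm (B := C)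
      (fun x => hK x ▸ hC _) hL (φ := fun _ r => φ (Real.sqrt r))
      (fun _ => hφ.comp fun _ _ h => Real.sqrt_le_sqrt h) (fun _ _ => hφ0 _) (fun _ _ => hφ1 _)
      (a := fun _ x θ => ‖θ.1.1‖ ^ 2 + -2 * inner ℝ x θ.1.1 + ‖x‖ ^ 2)
      (b := fun θ => θ.1.2.1 ^ 2) (fun _ _ => by fun_prop)
      (fun _ x => (KernelParam.isLinearIn_norm_sq.add
        ((KernelParam.isLinearIn_inner x).const_mul _)).add (KernelParam.isLinearIn_const _))
      KernelParam.isLinearIn_bandwidth_sq (fun θ => pow_pos θ.2 2) fun θ θ' x => ?_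
    have hnorm : ∀ θ : KernelParam d, ‖θ.1.2.1⁻¹ • (θ.1.1 - x)‖ =
        Real.sqrt ((‖θ.1.1‖ ^ 2 + -2 * inner ℝ x θ.1.1 + ‖x‖ ^ 2) / θ.1.2.1 ^ 2) := by
      intro θ
      rw [show ‖θ.1.1‖ ^ 2 + -2 * inner ℝ x θ.1.1 + ‖x‖ ^ 2 = ‖θ.1.1 - x‖ ^ 2 by
        rw [norm_sub_sq_real, real_inner_comm]; ring, ← div_pow, Real.sqrt_sq
        (div_nonneg (norm_nonneg _) θ.2.le), norm_smul, norm_inv, Real.norm_of_nonneg θ.2.le,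
        div_eq_inv_mul]
    rw [hK, hK, hnorm, hnorm]
    simpa using hφL _ _
  · have hKm : Measurable K := by
      rw [show K = fun x => ∏ k, K₀ (x k) from funext hK]
      exact Finset.measurable_fun_prod _ fun k _ => hK₀m.comp (by fun_prop)
    -- The bound is raised to at least 1 for the factor-by-factor comparison of products.
    have hB1 : 1 ≤ max 1 C := le_max_left _ _
    have hB : ∀ u, |K₀ u| ≤ max 1 C := fun u => (hC u).trans (le_max_right _ _)
    refine isVCClassWithEnvelope_of_increments (κ := Fin d) hKm (B := max 1 C ^ d)
      (L := max 1 C ^ d * L) (fun x => ?_) (by positivity) (φ := fun _ => φ) (fun _ => hφ)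
      (fun _ => hφ0) (fun _ => hφ1) (a := fun k x θ => θ.1.1 k + -x k) (b := fun θ => θ.1.2.1)
      (fun _ _ => by fun_prop)
      (fun k x => (KernelParam.isLinearIn_coord k).add (KernelParam.isLinearIn_const _))
      KernelParam.isLinearIn_bandwidth (fun θ => θ.2) fun θ θ' x => ?_
    · rw [hK, Finset.abs_prod]
      exact (Finset.prod_le_prod (fun k _ => abs_nonneg _) fun k _ => hB (x k)).trans_eq (by simp)
    · rw [hK, hK]
      refine (abs_prod_sub_prod_le Finset.univ hB1 (fun _ => hB _) fun _ => hB _).trans ?_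
      rw [Finset.card_univ, Fintype.card_fin, mul_assoc]
      refine mul_le_mul_of_nonneg_left ?_ (by positivity)
      rw [Finset.mul_sum]
      refine Finset.sum_le_sum fun k _ => ?_
      simpa [div_eq_inv_mul, sub_eq_add_neg, mul_add] using
        hφL ((θ.1.2.1⁻¹ • (θ.1.1 - x)) k) ((θ'.1.2.1⁻¹ • (θ'.1.1 - x)) k)
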